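/- Let $d\ge 0$ and let $\phi$ be a state on $\mathbb C\langle x_1,\dots,x_d\rangle$, i.e. a linear functional with $\phi(1)=1$, $\phi(p^*)=\overline{\phi(p)}$ and $\phi(p^*p)\ge 0$ for all $p$, where $(\alpha x_{u(1)}\cdots x_{u(k)})^*=\bar\alpha\,x_{u(k)}\cdots x_{u(1)}$. Suppose that $\phi$ has a monic orthogonal polynomial system (MOPS): polynomials $P_{\vec u}=x_{\vec u}+(\text{terms of degree}<|\vec u|)$, one for each multi-index $\vec u\in\bigcup_{k\ge0}\{1,\dots,d\}^k$, with $\phi(P_{\vec u}^*P_{\vec v})=0$ for $\vec u\ne\vec v$. By *Fock space matrices* we mean diagonal non-negative $d^k\times d^k$ matrices $\mathcal C^{(k)}$, $k\ge1$, with diagonal entries $\mathcal C_{\vec u}$, and $d^k\times d^k$ complex matrices $\mathcal T_i^{(k)}=(B_{i,\vec w,\vec u})_{\vec w,\vec u}$, $1\le i\le d$, $k\ge0$, all acting on $(\mathbb C^d)^{\otimes k}$ with basis $e_{\vec u}=e_{u(1)}\otimes\cdots\otimes e_{u(k)}$, such that $(\mathcal T_i^{(k)})^*\mathcal K^{(k)}=\mathcal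 K^{(k)}\mathcal T_i^{(k)}$, where $\mathcal K^{(k)}=(I^{\otimes(k-1)}\otimes\mathcal C^{(1)})\cdots(I\otimes\mathcal C^{(k-1)})\,\mathcal C^{(k)}$ and $\mathcal K^{(0)}=1$. On the algebraic full Fock space $\mathbb C\Omega\oplus\bigoplus_{k\ge1}(\mathbb C^d)^{\otimes k}$ let $\mathcal X_i=a_i^++\mathcal T_i+a_i^-\mathcal C$, with $a_i^+,a_i^-$ the left free creation and annihilation operators and $\mathcal T_i,\mathcal C$ acting componentwise. The matrices *represent* $\phi$ if $\phi(p(x_1,\dots,x_d))=\langle\Omega,p(\mathcal X_1,\dots,\mathcal X_d)\Omega\rangle$ for all $p$. They are *recursion coefficients* of a MOPS $\{P_{\vec u}\}$ if for all $i$ and $\vec u$ $$x_iP_{\vec u}=P_{(i,\vec u)}+\sum_{|\vec w|=|\vec u|}B_{i,\vec w,\vec u}P_{\vec w}+\delta_{i,u(1)}\,\mathcal C_{\vec u}\,P_{(u(2),\dots,u(k))},\qquad k=|\vec u|,$$ the last term being absent for $\vec u=\emptyset$. Then: 1. there are Fock space matrices that represent $\phi$ and are the recursion coefficients of some MOPS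 of $\phi$; 2. for all Fock space matrices that represent $\phi$, and for all Fock space matrices that are recursion coefficients of some MOPS of $\phi$, the moment generating function $M(\mathbf z)=\sum_{|\vec u|\ge1}\phi(x_{\vec u})z_{\vec u}$, a formal power series in non-commuting indeterminates $z_1,\dots,z_d$, satisfies $$1+M(\mathbf z)=\cfrac{1}{1-\sum_{i_0}z_{i_0}\mathcal T^{(0)}_{i_0}-\cfrac{\sum_{j_1}z_{j_1}E_{j_1}\mathcal C^{(1)}\,\big|\,\sum_{k_1}E_{k_1}z_{k_1}}{1-\sum_{i_1}z_{i_1}\mathcal T^{(1)}_{i_1}-\cfrac{\sum_{j_2}z_{j_2}E_{j_2}\mathcal C^{(2)}\,\big|\,\sum_{k_2}E_{k_2}z_{k_2}}{1-\sum_{i_2}z_{i_2}\mathcal T^{(2)}_{i_2}-\cdots}}}.$$ Here the numerator and denominator at level $s$ are formal power series in $\mathbf z$ whose coefficients are $d^s\times d^s$ matrices (the $z_i$ commute with the matrices but not with each other); $\dfrac{E_jA\,|\,E_k}{B}=\langle e_j\otimes I\otimes\cdots\otimes I,\;AB^{-1}(e_k\otimes I\otimes\cdots\otimes I)\rangle$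 is the $(j,k)$ block, of size $d^{s-1}\times d^{s-1}$, of the $d^s\times d^s$ matrix series $AB^{-1}$; the factors $z_j$ and $z_k$ multiply this block from the left and from the right, respectively; and the equality means that the finite continued fractions obtained by deleting everything below level $n$ converge to $1+M(\mathbf z)$ coefficientwise, i.e. each coefficient is equal to that of $1+M(\mathbf z)$ for all sufficiently large $n$. -/

import Mathlib

open scoped ComplexConjugate

noncomputable section

/-! ### Polynomials in non-commuting variables, states, orthogonal polynomials -/

/-- `ℂ⟨x₁, …, x_d⟩`, the polynomials in `d` non-commuting variables. -/
abbrev NCPoly (d : ℕ) : Type := FreeAlgebra ℂ (Fin d)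

/-- The monomial `x_w = x_{w(1)} ⋯ x_{w(n)}`. -/
def ncMonomial {d : ℕ} (w : List (Fin d)) : NCPoly d :=
  (w.map (FreeAlgebra.ι ℂ)).prod

/-- The conjugate-linear involution with `(α x_w)^* = conj α · x_{w reversed}`.
(Mathlib's `star` on `FreeAlgebra` is linear: it does not conjugate the coefficients.) -/
def adj {d : ℕ} (p : NCPoly d) : NCPoly d :=
  ((FreeAlgebra.basisFreeMonoid ℂ (Fin d)).repr p).sum
    fun w a => conj a • ncMonomial (FreeMonoid.toList w).reverse

theorem adj_smul_ncMonomial {d : ℕ} (a : ℂ) (w : List (Fin d)) :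
    adj (a • ncMonomial w) = conj a • ncMonomial w.reverse := by
  have h : ncMonomial w =
      FreeAlgebra.basisFreeMonoid ℂ (Fin d) (FreeMonoid.ofList w) := by
    simp [FreeAlgebra.basisFreeMonoid, FreeAlgebra.equivMonoidAlgebraFreeMonoid, ncMonomial,
      FreeMonoid.lift_apply]
  rw [h, adj, map_smul, Module.Basis.repr_self, Finsupp.smul_single, Finsupp.sum_single_index]
  · simp
  · simp

/-- A state: a unital, `*`-compatible, positive linear functional. -/
structure IsState {d : ℕ} (φ : NCPoly d →ₗ[ℂ] ℂ) : Prop where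
  map_one : φ 1 = 1
  map_adj : ∀ p, φ (adj p) = conj (φ p)
  im_eq_zero : ∀ p, (φ (adj p * p)).im = 0
  nonneg : ∀ p, 0 ≤ (φ (adj p * p)).re

/-- Multi-indices: words of arbitrary length `k ≥ 0` in the letters `1, …, d`. -/
abbrev MultiIndex (d : ℕ) : Type := Σ k : ℕ, (Fin k → Fin d)

/-- A monic orthogonal polynomial system for `φ`: a family `P_u = x_u + (terms of degree < |u|)`
which is orthogonal for `⟨p, q⟩ = φ(p^* q)`. -/
structure IsMOPS {d : ℕ} (φ : NCPoly d →ₗ[ℂ] ℂ) (P : MultiIndex d → NCPoly d) : Prop where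
  monic : ∀ u : MultiIndex d, P u - ncMonomial (List.ofFn u.2) ∈
    Submodule.span ℂ (ncMonomial '' {w : List (Fin d) | w.length < u.1})
  orthogonal : ∀ u v : MultiIndex d, u ≠ v → φ (adj (P u) * P v) = 0

/-! ### Fock space representations -/

/-- The diagonal of `K_C^{(k)} = (I ⊗ ⋯ ⊗ I ⊗ C^{(1)}) ⋯ (I ⊗ C^{(k-1)}) C^{(k)}`;
here `C k` is the diagonal of `C^{(k+1)}`, and `K_C^{(0)} = 1`. -/
def kDiag {d : ℕ} (C : ∀ k : ℕ, (Fin (k + 1) → Fin d) → ℝ) : ∀ k : ℕ, (Fin k → Fin d) → ℝ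
  | 0, _ => 1
  | k + 1, u => kDiag C k (Matrix.vecTail u) * C k u

/-- The matrix `K_C^{(k)}`. -/
def kMatrix {d : ℕ} (C : ∀ k : ℕ, (Fin (k + 1) → Fin d) → ℝ) (k : ℕ) :
    Matrix (Fin k → Fin d) (Fin k → Fin d) ℂ :=
  Matrix.diagonal fun u => (kDiag C k u : ℂ)

/-- The matrices defining a Fock space representation: for `k ≥ 1` the diagonal non-negative
`d^k × d^k` matrix `C^{(k)}` (its diagonal is `diagC (k - 1)`), and for `k ≥ 0` the `d^k × d^k`
matrices `T_i^{(k)}`, subject to `(T_i^{(k)})^* K_C^{(k)} = K_C^{(k)} T_i^{(k)}`. -/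
structure FockMatrices (d : ℕ) where
  diagC : ∀ k : ℕ, (Fin (k + 1) → Fin d) → ℝ
  T : Fin d → ∀ k : ℕ, Matrix (Fin k → Fin d) (Fin k → Fin d) ℂ
  diagC_nonneg : ∀ k u, 0 ≤ diagC k u
  comm : ∀ i k, (T i k).conjTranspose * kMatrix diagC k = kMatrix diagC k * T i k

/-- The matrix `C^{(k+1)}`. -/
def FockMatrices.C {d : ℕ} (F : FockMatrices d) (k : ℕ) :
    Matrix (Fin (k + 1) → Fin d) (Fin (k + 1) → Fin d) ℂ :=
  Matrix.diagonal fun u => (F.diagC k u : ℂ)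

/-- The algebraic full Fock space `ℂΩ ⊕ ⨁_{k ≥ 1} (ℂ^d)^{⊗k}`, written in its basis
`e_u = e_{u(1)} ⊗ ⋯ ⊗ e_{u(k)}`, with `e_∅ = Ω`. -/
abbrev FockSpace (d : ℕ) : Type := MultiIndex d →₀ ℂ

/-- The basis vector `e_{u(1)} ⊗ ⋯ ⊗ e_{u(k)}`. -/
def fockBasis {d : ℕ} {k : ℕ} (u : Fin k → Fin d) : FockSpace d := Finsupp.single ⟨k, u⟩ 1

/-- The vacuum vector `Ω`. -/
def vacuum (d : ℕ) : FockSpace d := fockBasis (k := 0) Matrix.vecEmpty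

/-- The operator on Fock space with prescribed values on the basis. -/
def fockOp {d : ℕ} (f : MultiIndex d → FockSpace d) : Module.End ℂ (FockSpace d) :=
  Finsupp.linearCombination ℂ f

/-- The free creation operator `a_i^+`. -/
def creation {d : ℕ} (i : Fin d) : Module.End ℂ (FockSpace d) :=
  fockOp fun u => fockBasis (Matrix.vecCons i u.2)

/-- The free annihilation operator `a_i^-`. -/
def annihilation {d : ℕ} (i : Fin d) : Module.End ℂ (FockSpace d) :=
  fockOp fun u => match u with
    | ⟨0, _⟩ => 0
    | ⟨_ + 1, u⟩ => if i = Matrix.vecHead u then fockBasis (Matrix.vecTail u) else 0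

namespace FockMatrices

variable {d : ℕ} (F : FockMatrices d)

/-- The operator `T_i` acting as `T_i^{(k)}` on the `k`-th component. -/
def opT (i : Fin d) : Module.End ℂ (FockSpace d) :=
  fockOp fun u => ∑ w : Fin u.1 → Fin d, F.T i u.1 w u.2 • fockBasis w

/-- The operator `C` acting as `C^{(k)}` on the `k`-th component, `k ≥ 1`. It is only ever
followed by an annihilation operator, so its value on the vacuum, here `0`, is immaterial. -/
def opC : Module.End ℂ (FockSpace d) :=
  fockOp fun u => match u with
    | ⟨0, _⟩ => 0
    | ⟨k + 1, u⟩ => ∑ w : Fin (k + 1) → Fin d, F.C k w u • fockBasis w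

/-- `X_i = a_i^+ + T_i + a_i^- C`. -/
def opX (i : Fin d) : Module.End ℂ (FockSpace d) :=
  creation i + F.opT i + annihilation i * F.opC

/-- The (pre-)inner product `⟨ξ, η⟩_C`, conjugate-linear in `ξ`, for which the components are
orthogonal and which is `⟨ξ, K_C^{(k)} η⟩` on the `k`-th one. -/
def inner (ξ η : FockSpace d) : ℂ :=
  ξ.sum fun u a => conj a * (kDiag F.diagC u.1 u.2 : ℂ) * η u

/-- `F` gives a Fock space representation of `φ`:
`φ(p(x₁, …, x_d)) = ⟨Ω, p(X₁, …, X_d) Ω⟩`. -/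
def Represents (φ : NCPoly d →ₗ[ℂ] ℂ) : Prop :=
  ∀ p : NCPoly d, φ p = F.inner (vacuum d) (FreeAlgebra.lift ℂ F.opX p (vacuum d))

/-- The entries of the matrices are the coefficients in the recursion relation
`x_i P_u = P_{(i,u)} + ∑_{|w| = |u|} (T_i^{(k)})_{w,u} P_w + δ_{i,u(1)} C_u P_{(u(2),…,u(k))}`,
`k = |u|`, where the last term is absent for `u = ∅`. -/
structure IsRecursionOf (P : MultiIndex d → NCPoly d) : Prop where
  zero : ∀ (i : Fin d) (u : Fin 0 → Fin d), FreeAlgebra.ι ℂ i * P ⟨0, u⟩ =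
    P ⟨1, Matrix.vecCons i u⟩ + ∑ w : Fin 0 → Fin d, F.T i 0 w u • P ⟨0, w⟩
  succ : ∀ (i : Fin d) (k : ℕ) (u : Fin (k + 1) → Fin d), FreeAlgebra.ι ℂ i * P ⟨k + 1, u⟩ =
    P ⟨k + 2, Matrix.vecCons i u⟩ + ∑ w : Fin (k + 1) → Fin d, F.T i (k + 1) w u • P ⟨k + 1, w⟩ +
      (if i = Matrix.vecHead u then (F.diagC k u : ℂ) • P ⟨k, Matrix.vecTail u⟩ else 0)

end FockMatrices

/-! ### Formal power series in non-commuting variables -/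

/-- Formal power series in non-commuting indeterminates `z₁, …, z_d` with coefficients in `R`;
the indeterminates commute with the coefficients. `f.coeff w` is the coefficient of
`z_w = z_{w(1)} ⋯ z_{w(n)}`. -/
@[ext] structure NCSeries (d : ℕ) (R : Type*) where
  coeff : List (Fin d) → R

namespace NCSeries

variable {d : ℕ} {R S : Type*}

/-- Apply a map to every coefficient. -/
def map (h : R → S) (f : NCSeries d R) : NCSeries d S := ⟨fun w => h (f.coeff w)⟩

section Ring

variable [Ring R]

/-- The constant series. -/
def const (a : R) : NCSeries d R := ⟨fun w => if w = [] then a else 0⟩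

/-- The indeterminate `z_i`. -/
def z (i : Fin d) : NCSeries d R := ⟨fun w => if w = [i] then 1 else 0⟩

instance : Zero (NCSeries d R) := ⟨⟨fun _ => 0⟩⟩

instance : One (NCSeries d R) := ⟨const 1⟩

instance : Add (NCSeries d R) := ⟨fun f g => ⟨fun w => f.coeff w + g.coeff w⟩⟩

instance : Neg (NCSeries d R) := ⟨fun f => ⟨fun w => -f.coeff w⟩⟩

/-- The product: the coefficient of `z_w` is the sum of `f_u g_v` over all factorizations
`w = (u, v)`. -/
instance : Mul (NCSeries d R) :=
  ⟨fun f g => ⟨fun w =>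
    ∑ n ∈ Finset.range (w.length + 1), f.coeff (w.take n) * g.coeff (w.drop n)⟩⟩

theorem coeff_zero (w : List (Fin d)) : (0 : NCSeries d R).coeff w = 0 := rfl

theorem coeff_one (w : List (Fin d)) :
    (1 : NCSeries d R).coeff w = if w = [] then 1 else 0 := rfl

theorem coeff_add (f g : NCSeries d R) (w : List (Fin d)) :
    (f + g).coeff w = f.coeff w + g.coeff w := rfl

theorem coeff_neg (f : NCSeries d R) (w : List (Fin d)) : (-f).coeff w = -f.coeff w := rfl

theorem coeff_mul (f g : NCSeries d R) (w : List (Fin d)) : (f * g).coeff w =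
    ∑ n ∈ Finset.range (w.length + 1), f.coeff (w.take n) * g.coeff (w.drop n) := rfl

theorem coeff_nil_mul (f g : NCSeries d R) :
    (f * g).coeff [] = f.coeff [] * g.coeff [] := by
  simp [coeff_mul]

theorem coeff_nil_z (i : Fin d) : (z i : NCSeries d R).coeff [] = 0 := by
  simp [z]

/-- The series with coefficients `w ↦ f_{(a, w)}`. -/
def tail (a : Fin d) (f : NCSeries d R) : NCSeries d R := ⟨fun w => f.coeff (a :: w)⟩

theorem coeff_cons_mul (f g : NCSeries d R) (a : Fin d) (w : List (Fin d)) :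
    (f * g).coeff (a :: w) = f.coeff [] * g.coeff (a :: w) + (tail a f * g).coeff w := by
  rw [coeff_mul, List.length_cons, Finset.sum_range_succ', add_comm, coeff_mul]
  rfl

theorem add_mul_aux (f g h : NCSeries d R) : (f + g) * h = f * h + g * h := by
  ext w
  simp only [coeff_mul, coeff_add, add_mul, Finset.sum_add_distrib]

theorem zero_mul_aux (f : NCSeries d R) : 0 * f = 0 := by
  ext w
  simp [coeff_mul, coeff_zero]

instance : Ring (NCSeries d R) where
  add_assoc f g h := by ext w; simp only [coeff_add, add_assoc]
  zero_add f := by ext w; simp only [coeff_add, coeff_zero, zero_add]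
  add_zero f := by ext w; simp only [coeff_add, coeff_zero, add_zero]
  add_comm f g := by ext w; simp only [coeff_add, add_comm]
  neg_add_cancel f := by ext w; simp only [coeff_add, coeff_neg, coeff_zero, neg_add_cancel]
  nsmul := nsmulRec
  zsmul := zsmulRec
  left_distrib f g h := by
    ext w
    simp only [coeff_mul, coeff_add, mul_add, Finset.sum_add_distrib]
  right_distrib := add_mul_aux
  zero_mul := zero_mul_aux
  mul_zero f := by
    ext w
    simp [coeff_mul, coeff_zero]
  one_mul f := by
    ext w
    cases w with
    | nil => simp [coeff_nil_mul, coeff_one]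
    | cons a w =>
      have h : tail a (1 : NCSeries d R) = 0 := by
        ext v
        simp [tail, coeff_one, coeff_zero]
      rw [coeff_cons_mul, h, zero_mul_aux, coeff_one, if_pos rfl, one_mul, coeff_zero, add_zero]
  mul_one f := by
    ext w
    induction w generalizing f with
    | nil => simp [coeff_nil_mul, coeff_one]
    | cons a w ih =>
      rw [coeff_cons_mul, ih, coeff_one, if_neg (List.cons_ne_nil _ _), mul_zero, zero_add]
      rfl
  mul_assoc f g h := by
    ext w
    induction w generalizing f with
    | nil => simp only [coeff_nil_mul, mul_assoc]
    | cons a w ih =>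
      have key : tail a (f * g) = ⟨fun v => f.coeff [] * (tail a g).coeff v⟩ + tail a f * g := by
        ext v
        exact coeff_cons_mul f g a v
      have hs : ((⟨fun v => f.coeff [] * (tail a g).coeff v⟩ : NCSeries d R) * h).coeff w =
          f.coeff [] * (tail a g * h).coeff w := by
        rw [coeff_mul, coeff_mul, Finset.mul_sum]
        exact Finset.sum_congr rfl fun n _ => mul_assoc _ _ _
      rw [coeff_cons_mul, coeff_cons_mul, coeff_cons_mul, key, add_mul_aux, coeff_add, hs, ih,
        coeff_nil_mul, mul_add, mul_assoc, add_assoc]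

theorem coeff_sub (f g : NCSeries d R) (w : List (Fin d)) :
    (f - g).coeff w = f.coeff w - g.coeff w := by
  rw [sub_eq_add_neg, coeff_add, coeff_neg, sub_eq_add_neg]

/-- The coefficients of the right inverse of a series `f` with constant term `1`. -/
def rightInv (f : NCSeries d R) : List (Fin d) → R
  | [] => 1
  | a :: w => -∑ n : Fin (w.length + 1),
      f.coeff ((a :: w).take (n + 1)) * rightInv f (w.drop n)
  termination_by w => w.length
  decreasing_by simp

theorem isUnit_of_coeff_nil_eq_one {f : NCSeries d R} (hf : f.coeff [] = 1) : IsUnit f := by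
  have key : ∀ g : NCSeries d R, g.coeff [] = 1 →
      ∃ h : NCSeries d R, g * h = 1 ∧ h.coeff [] = 1 := by
    intro g hg
    have h1 : rightInv g [] = 1 := by rw [rightInv]
    refine ⟨⟨rightInv g⟩, ?_, h1⟩
    ext w
    cases w with
    | nil =>
      rw [coeff_nil_mul, hg, coeff_one, if_pos rfl, one_mul]
      exact h1
    | cons a w =>
      rw [coeff_mul, List.length_cons, Finset.sum_range_succ', List.drop_zero, List.take_zero, hg,
        one_mul, Finset.sum_range, coeff_one, if_neg (List.cons_ne_nil _ _)]
      have h2 : rightInv g (a :: w) = -∑ n : Fin (w.length + 1),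
          g.coeff ((a :: w).take (n + 1)) * rightInv g (w.drop n) := by rw [rightInv]
      exact (congrArg (_ + ·) h2).trans (add_neg_cancel _)
  obtain ⟨g, hfg, hg⟩ := key f hf
  obtain ⟨h, hgh, -⟩ := key g hg
  have : f = h := by rw [← mul_one f, ← hgh, ← mul_assoc, hfg, one_mul]
  exact ⟨⟨f, g, hfg, this ▸ hgh⟩, rfl⟩

end Ring

end NCSeries

/-- The moment generating function `M(z) = ∑_{|u| ≥ 1} φ(x_u) z_u`; the constant term `φ(1) = 1` is
left out, so that `1 + M(z)` is the generating function of all moments. -/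
def momentSeries {d : ℕ} (φ : NCPoly d →ₗ[ℂ] ℂ) : NCSeries d ℂ :=
  ⟨fun w => if w = [] then 0 else φ (ncMonomial w)⟩

/-! ### The continued fraction -/

/-- `⟨e_i ⊗ I ⊗ ⋯ ⊗ I, A (e_j ⊗ I ⊗ ⋯ ⊗ I)⟩`: the `d^k × d^k` block at position `(i, j)` of a
`d^(k+1) × d^(k+1)` matrix `A`. -/
def block {d k : ℕ} (i j : Fin d) (A : Matrix (Fin (k + 1) → Fin d) (Fin (k + 1) → Fin d) ℂ) :
    Matrix (Fin k → Fin d) (Fin k → Fin d) ℂ :=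
  Matrix.of fun u v => A (Matrix.vecCons i u) (Matrix.vecCons j v)

/-- Power series whose coefficients are `d^k × d^k` matrices; equivalently, `d^k × d^k` matrices of
power series. -/
abbrev MatrixSeries (d k : ℕ) : Type := NCSeries d (Matrix (Fin k → Fin d) (Fin k → Fin d) ℂ)

/-- The fraction `(E_i A | E_j) / B = ⟨e_i ⊗ I ⊗ ⋯ ⊗ I, A B⁻¹ (e_j ⊗ I ⊗ ⋯ ⊗ I)⟩`. -/
def barFraction {d k : ℕ} (i j : Fin d) (A B : MatrixSeries d (k + 1)) : MatrixSeries d k :=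
  NCSeries.map (block i j) (A * Ring.inverse B)

namespace FockMatrices

variable {d : ℕ} (F : FockMatrices d)

/-- The denominator at level `s` of the continued fraction when `n` further levels are kept:
`1 - ∑ z_i T_i^{(s)} - (∑ z_j E_j C^{(s+1)} | ∑ E_k z_k) / (denominator at level s + 1)`,
and `1 - ∑ z_i T_i^{(s)}` for `n = 0`. -/
def denominator : ∀ _n s : ℕ, MatrixSeries d s
  | 0, s => 1 - ∑ i : Fin d, NCSeries.z i * NCSeries.const (F.T i s)
  | n + 1, s => 1 - ∑ i : Fin d, NCSeries.z i * NCSeries.const (F.T i s) -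
      ∑ j : Fin d, ∑ k : Fin d, NCSeries.z j *
        barFraction j k (NCSeries.const (F.C s)) (denominator n (s + 1)) * NCSeries.z k

/-- The denominators have constant term `1`, hence all inverses below are genuine. -/
theorem isUnit_denominator (n s : ℕ) : IsUnit (F.denominator n s) := by
  have hsum : ∀ {k : ℕ} (f : Fin d → MatrixSeries d k),
      (∀ i, (f i).coeff [] = 0) → (∑ i, f i).coeff [] = 0 := by
    intro k f hf
    refine Finset.sum_induction f (fun g => g.coeff [] = 0) (fun g h hg hh => ?_) rfl
      fun i _ => hf i
    rw [NCSeries.coeff_add, hg, hh, add_zero]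
  apply NCSeries.isUnit_of_coeff_nil_eq_one
  cases n with
  | zero =>
    rw [denominator, NCSeries.coeff_sub, hsum, sub_zero]
    · rfl
    · intro i
      rw [NCSeries.coeff_nil_mul, NCSeries.coeff_nil_z, zero_mul]
  | succ n =>
    rw [denominator, NCSeries.coeff_sub, NCSeries.coeff_sub, hsum, hsum, sub_zero, sub_zero]
    · rfl
    · intro j
      refine hsum _ fun k => ?_
      rw [NCSeries.coeff_nil_mul, NCSeries.coeff_nil_z, mul_zero]
    · intro i
      rw [NCSeries.coeff_nil_mul, NCSeries.coeff_nil_z, zero_mul]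

/-- The `n`-th convergent of the continued fraction: everything below level `n` is cut off. -/
def convergent (n : ℕ) : MatrixSeries d 0 := Ring.inverse (F.denominator n 0)

/-- The infinite continued fraction equals the series `G`: the convergents tend to `G` in the
topology of formal power series, that is, every coefficient is eventually constant with the
right value. The convergents have `1 × 1` matrices as coefficients. -/
def ContinuedFractionEq (G : NCSeries d ℂ) : Prop :=
  ∀ w : List (Fin d), ∀ᶠ n in Filter.atTop,
    (F.convergent n).coeff w Matrix.vecEmpty Matrix.vecEmpty = G.coeff w

end FockMatrices

end

open scoped ComplexConjugate

noncomputable section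

/-! ### The conjugate-linear involution -/

section Adjoint

variable {d : ℕ}

/-! The form `⟨p, q⟩ = φ(p^* q)` may be degenerate, so a given MOPS `P` need not satisfy the
recursion exactly, only modulo null vectors. Its would-be coefficients are `C_u = ‖P_u‖² / ‖P_{tail
u}‖²` and `B_{i,w,u} = ⟨P_w, x_i P_u⟩ / ‖P_w‖²`, with value `0` when the denominator vanishes;
Cauchy–Schwarz makes the numerator vanish too in that case, so the relations survive
(`IsMOPS.fockMatrices`). Running the exact recursion with these coefficients yields monic
polynomials that differ from `P` by null vectors (`IsMOPS.stateForm_poly_sub`), hence again a MOPS,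
now with genuine recursion coefficients.

Recursion coefficients always represent `φ`: the map `e_u ↦ P_u` intertwines `X_i` with
multiplication by `x_i`, and `φ(P_u) = ⟨1, P_u⟩` vanishes for `u ≠ ∅`, so `φ` becomes the vacuum
coordinate (`IsRecursionOf.represents`).

It remains to treat matrices that represent `φ`. Let `H_s` be the generating series of the level `s`
components of `X_w Ω`. The definition of `X_i` is a three-term relation `H_s = R_s + ∑ z_i T_i H_s +
∑ z_j ⟨e_j, C H_{s+1}⟩`, where `R_0 = 1` and `R_{s+1} = (∑ E_k z_k) H_s` (`levelSeries_eq`).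
Eliminating levels gives the continued fraction: `denominator n s * H_s` agrees with `R_s` on words
of length at most `n` (`orderGE_denominator_mul_sub`), because each level contributes a factor `z_j`
to the error. At `s = 0`, inverting the denominator gives the claim, as `H_0 = 1 + M`. -/

theorem adj_add (p q : NCPoly d) : adj (p + q) = adj p + adj q := by
  classical
  simp only [adj, map_add]
  exact Finsupp.sum_add_index' (by simp) (by simp [add_smul])

theorem adj_smul (a : ℂ) (p : NCPoly d) : adj (a • p) = conj a • adj p := by
  simp only [adj, map_smul]
  rw [Finsupp.sum_smul_index' (by simp), Finsupp.smul_sum]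
  simp [mul_smul]

theorem ncMonomial_cons (i : Fin d) (w : List (Fin d)) :
    ncMonomial (i :: w) = FreeAlgebra.ι ℂ i * ncMonomial w := by
  simp [ncMonomial]

theorem ncMonomial_append (v w : List (Fin d)) :
    ncMonomial (v ++ w) = ncMonomial v * ncMonomial w := by
  simp [ncMonomial]

theorem span_ncMonomial :
    Submodule.span ℂ (Set.range (ncMonomial : List (Fin d) → NCPoly d)) = ⊤ := by
  rw [eq_top_iff, ← (FreeAlgebra.basisFreeMonoid ℂ (Fin d)).span_eq, Submodule.span_le]
  rintro _ ⟨w, rfl⟩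
  refine Submodule.subset_span ⟨FreeMonoid.toList w, ?_⟩
  simp [FreeAlgebra.basisFreeMonoid, FreeAlgebra.equivMonoidAlgebraFreeMonoid, ncMonomial,
      FreeMonoid.lift_apply]

theorem adj_ncMonomial (w : List (Fin d)) : adj (ncMonomial w) = ncMonomial w.reverse := by
  simpa using adj_smul_ncMonomial 1 w

theorem induction_ncMonomial {motive : NCPoly d → Prop} (monomial : ∀ w, motive (ncMonomial w))
    (add : ∀ p q, motive p → motive q → motive (p + q))
    (smul : ∀ (a : ℂ) p, motive p → motive (a • p)) (p : NCPoly d) : motive p := by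
  have hp : p ∈ Submodule.span ℂ (Set.range (ncMonomial : List (Fin d) → NCPoly d)) := by
    rw [span_ncMonomial]; trivial
  induction hp using Submodule.span_induction with
  | mem x hx => obtain ⟨w, rfl⟩ := hx; exact monomial w
  | zero => simpa using smul 0 _ (monomial [])
  | add p q _ _ hp hq => exact add p q hp hq
  | smul a p _ hp => exact smul a p hp

theorem adj_mul (p q : NCPoly d) : adj (p * q) = adj q * adj p := by
  induction p using induction_ncMonomial with
  | monomial v =>
    induction q using induction_ncMonomial with
    | monomial w => simp only [← ncMonomial_append, adj_ncMonomial, List.reverse_append]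
    | add p q hp hq => simp only [mul_add, adj_add, hp, hq, add_mul]
    | smul a p hp => simp only [mul_smul_comm, adj_smul, hp, smul_mul_assoc]
  | add p q hp hq => simp only [mul_add, adj_add, hp, hq, add_mul]
  | smul a p hp => simp only [smul_mul_assoc, adj_smul, hp, mul_smul_comm]

theorem adj_adj (p : NCPoly d) : adj (adj p) = p := by
  induction p using induction_ncMonomial with
  | monomial w => simp only [adj_ncMonomial, List.reverse_reverse]
  | add p q hp hq => simp only [adj_add, hp, hq]
  | smul a p hp => simp only [adj_smul, hp, Complex.conj_conj]

theorem adj_ι (i : Fin d) : adj (FreeAlgebra.ι ℂ i) = FreeAlgebra.ι ℂ i := by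
  simpa [ncMonomial] using adj_ncMonomial [i]

end Adjoint

/-! ### The semi-definite form of a state -/

section Form

variable {d : ℕ} (φ : NCPoly d →ₗ[ℂ] ℂ)

/-- The sesquilinear form `⟨p, q⟩ = φ(p^* q)`. -/
def stateForm : NCPoly d →ₛₗ[starRingEnd ℂ] NCPoly d →ₗ[ℂ] ℂ where
  toFun p := φ ∘ₗ LinearMap.mulLeft ℂ (adj p)
  map_add' p q := by ext x; simp [adj_add, add_mul]
  map_smul' a p := by ext x; simp [adj_smul]

theorem stateForm_apply (p q : NCPoly d) : stateForm φ p q = φ (adj p * q) := rfl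

theorem stateForm_ι_mul (i : Fin d) (p q : NCPoly d) :
    stateForm φ p (FreeAlgebra.ι ℂ i * q) = stateForm φ (FreeAlgebra.ι ℂ i * p) q := by
  rw [stateForm_apply, stateForm_apply, adj_mul, adj_ι, mul_assoc]

variable {φ}

theorem IsState.stateForm_conj (hφ : IsState φ) (p q : NCPoly d) :
    conj (stateForm φ p q) = stateForm φ q p := by
  rw [stateForm_apply, stateForm_apply, ← hφ.map_adj, adj_mul, adj_adj]

theorem IsState.stateForm_self (hφ : IsState φ) (p : NCPoly d) :
    (((stateForm φ p p).re : ℝ) : ℂ) = stateForm φ p p :=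
  Complex.ext rfl (hφ.im_eq_zero p).symm

/-- The Cauchy–Schwarz inequality in the degenerate case. -/
theorem IsState.stateForm_eq_zero (hφ : IsState φ) {p : NCPoly d} (hp : stateForm φ p p = 0)
    (q : NCPoly d) : stateForm φ p q = 0 := by
  -- A pre-inner product suffices for Cauchy–Schwarz; definiteness is not available for a general
  -- state.
  let c : PreInnerProductSpace.Core ℂ (NCPoly d) :=
    { inner := fun p q => stateForm φ p q
      conj_inner_symm := fun p q => hφ.stateForm_conj q p
      re_inner_nonneg := hφ.nonneg
      add_left := fun p q r => by simp
      smul_left := fun p q a => by simp }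
  have h := InnerProductSpace.Core.inner_mul_inner_self_le (𝕜 := ℂ) (c := c) p q
  change ‖stateForm φ p q‖ * ‖stateForm φ q p‖ ≤ (stateForm φ p p).re * (stateForm φ q q).re at h
  rw [hp, Complex.zero_re, zero_mul, ← hφ.stateForm_conj p q, Complex.norm_conj] at h
  exact norm_eq_zero.mp (mul_self_eq_zero.mp (le_antisymm h (mul_self_nonneg _)))

end Form

/-! ### Degree filtration and monic systems -/

section Degree

variable {d : ℕ}

/-- The polynomials of degree less than `n`. -/
def degreeLT (d n : ℕ) : Submodule ℂ (NCPoly d) :=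
  Submodule.span ℂ (ncMonomial '' {w : List (Fin d) | w.length < n})

theorem ncMonomial_mem_degreeLT {n : ℕ} {w : List (Fin d)} (h : w.length < n) :
    ncMonomial w ∈ degreeLT d n := Submodule.subset_span ⟨w, h, rfl⟩

theorem degreeLT_zero : degreeLT d 0 = ⊥ := by simp [degreeLT]

theorem degreeLT_mono : Monotone (degreeLT d) := fun _ _ h =>
  Submodule.span_mono (Set.image_mono fun _ hw => lt_of_lt_of_le hw h)

theorem ι_mul_mem_degreeLT (i : Fin d) {n : ℕ} {p : NCPoly d} (hp : p ∈ degreeLT d n) :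
    FreeAlgebra.ι ℂ i * p ∈ degreeLT d (n + 1) := by
  have : degreeLT d n ≤ (degreeLT d (n + 1)).comap (LinearMap.mulLeft ℂ (FreeAlgebra.ι ℂ i)) := by
    refine Submodule.span_le.mpr ?_
    rintro _ ⟨w, hw, rfl⟩
    change FreeAlgebra.ι ℂ i * ncMonomial w ∈ degreeLT d (n + 1)
    rw [← ncMonomial_cons]
    exact ncMonomial_mem_degreeLT (by simpa using hw)
  exact this hp

/-- `P_u = x_u + (terms of degree < |u|)` for all `u`. -/
def IsMonicSystem (P : MultiIndex d → NCPoly d) : Prop :=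
  ∀ u : MultiIndex d, P u - ncMonomial (List.ofFn u.2) ∈ degreeLT d u.1

variable {P : MultiIndex d → NCPoly d}

/-- Triangularity: `x_w` is `P_w` minus a polynomial of lower degree, which the induction hypothesis
handles. -/
theorem IsMonicSystem.degreeLT_le (hP : IsMonicSystem P) (n : ℕ) :
    degreeLT d n ≤ Submodule.span ℂ (P '' {u | u.1 < n}) := by
  induction n with
  | zero => simp [degreeLT_zero]
  | succ n ih =>
    refine Submodule.span_le.mpr ?_
    rintro _ ⟨w, hw, rfl⟩
    have h : w.length ≤ n := Nat.lt_succ_iff.mp hw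
    have h1 := ih (degreeLT_mono h (hP ⟨w.length, w.get⟩))
    rw [List.ofFn_get] at h1
    have h2 : P ⟨w.length, w.get⟩ ∈ Submodule.span ℂ (P '' {u | u.1 < n + 1}) :=
      Submodule.subset_span ⟨_, hw, rfl⟩
    simpa using sub_mem h2 (Submodule.span_mono (Set.image_mono fun u hu =>
      Nat.lt_succ_of_lt hu) h1)

theorem IsMonicSystem.span_eq_top (hP : IsMonicSystem P) :
    Submodule.span ℂ (Set.range P) = ⊤ := by
  rw [eq_top_iff, ← span_ncMonomial, Submodule.span_le]
  rintro _ ⟨w, rfl⟩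
  exact Submodule.span_mono (Set.image_subset_range _ _)
    (hP.degreeLT_le _ (ncMonomial_mem_degreeLT (Nat.lt_succ_self w.length)))

theorem IsMonicSystem.apply_zero (hP : IsMonicSystem P) (u : Fin 0 → Fin d) : P ⟨0, u⟩ = 1 := by
  have := hP ⟨0, u⟩
  rw [degreeLT_zero, Submodule.mem_bot, sub_eq_zero] at this
  simpa [ncMonomial] using this

theorem ncMonomial_ofFn_succ {k : ℕ} (u : Fin (k + 1) → Fin d) :
    ncMonomial (List.ofFn u) =
      FreeAlgebra.ι ℂ (Matrix.vecHead u) * ncMonomial (List.ofFn (Matrix.vecTail u)) := by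
  rw [List.ofFn_succ, ncMonomial_cons]
  rfl

/-- Both terms have the same leading monomial `x_u`, which cancels. -/
theorem IsMonicSystem.ι_mul_sub_mem (hP : IsMonicSystem P) {k : ℕ} (u : Fin (k + 1) → Fin d) :
    FreeAlgebra.ι ℂ (Matrix.vecHead u) * P ⟨k, Matrix.vecTail u⟩ - P ⟨k + 1, u⟩ ∈
      degreeLT d (k + 1) := by
  have h := sub_mem (ι_mul_mem_degreeLT (Matrix.vecHead u) (hP ⟨k, Matrix.vecTail u⟩))
    (hP ⟨k + 1, u⟩)
  dsimp only at h
  rwa [ncMonomial_ofFn_succ, mul_sub, sub_sub_sub_cancel_right] at h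

end Degree

/-! ### Fock space matrices of a MOPS -/

theorem IsMOPS.isMonicSystem {d : ℕ} {φ : NCPoly d →ₗ[ℂ] ℂ} {P : MultiIndex d → NCPoly d}
    (hP : IsMOPS φ P) : IsMonicSystem P := hP.monic

namespace IsMOPS

variable {d : ℕ} {φ : NCPoly d →ₗ[ℂ] ℂ} {P : MultiIndex d → NCPoly d}

theorem stateForm_eq_zero_of_mem (hP : IsMOPS φ P) {k n : ℕ} (u : Fin k → Fin d) (h : n ≤ k)
    {p : NCPoly d} (hp : p ∈ degreeLT d n) : stateForm φ (P ⟨k, u⟩) p = 0 := by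
  have : Submodule.span ℂ (P '' {u | u.1 < n}) ≤ LinearMap.ker (stateForm φ (P ⟨k, u⟩)) := by
    refine Submodule.span_le.mpr ?_
    rintro _ ⟨v, hv, rfl⟩
    refine hP.orthogonal _ _ fun e => ?_
    have : v.1 < n := hv
    rw [← e] at this
    exact absurd this (not_lt.mpr h)
  exact this (hP.isMonicSystem.degreeLT_le n hp)

/-- `⟨P_w, x_i P_u⟩ = ⟨P_w, P_{(i,u)}⟩` if `|w| > |u|`. -/
theorem stateForm_ι_mul_of_lt (hP : IsMOPS φ P) {k m : ℕ} (w : Fin m → Fin d)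
    (u : Fin (k + 1) → Fin d) (h : k < m) :
    stateForm φ (P ⟨m, w⟩) (FreeAlgebra.ι ℂ (Matrix.vecHead u) * P ⟨k, Matrix.vecTail u⟩) =
      stateForm φ (P ⟨m, w⟩) (P ⟨k + 1, u⟩) := by
  rw [← sub_eq_zero, ← map_sub]
  exact hP.stateForm_eq_zero_of_mem w h (hP.isMonicSystem.ι_mul_sub_mem u)

/-- `⟨P_w, x_i P_u⟩ = ⟨P_{(i,w)}, P_u⟩` if `|w| < |u|`. -/
theorem stateForm_ι_mul_of_gt (hP : IsMOPS φ P) (hφ : IsState φ) {k m : ℕ} (i : Fin d)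
    (w : Fin m → Fin d) (u : Fin k → Fin d) (h : m < k) :
    stateForm φ (P ⟨m, w⟩) (FreeAlgebra.ι ℂ i * P ⟨k, u⟩) =
      stateForm φ (P ⟨m + 1, Matrix.vecCons i w⟩) (P ⟨k, u⟩) := by
  -- Moving `x_i` to the other side and conjugating exchanges the roles of `w` and `u`, which
  -- reduces to the previous case.
  rw [stateForm_ι_mul, ← hφ.stateForm_conj, ← hφ.stateForm_conj (P ⟨k, u⟩)]
  exact congrArg _ (hP.stateForm_ι_mul_of_lt u (Matrix.vecCons i w) h)

/-- With `i` the head and `v` the tail of `u`, `‖P_u‖² = ⟨P_u, x_i P_v⟩ = ⟨x_i P_u, P_v⟩`, and this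
is `0` when `P_v` is a null vector. It is what makes the quotients `C_u` harmless when their
denominator is `0`. -/
theorem stateForm_vecCons_eq_zero (hP : IsMOPS φ P) (hφ : IsState φ) {k : ℕ}
    (u : Fin (k + 1) → Fin d)
    (h : stateForm φ (P ⟨k, Matrix.vecTail u⟩) (P ⟨k, Matrix.vecTail u⟩) = 0) :
    stateForm φ (P ⟨k + 1, u⟩) (P ⟨k + 1, u⟩) = 0 := by
  rw [← hP.stateForm_ι_mul_of_lt u u (Nat.lt_succ_self k), ← hφ.stateForm_conj, ← stateForm_ι_mul,
    hφ.stateForm_eq_zero h, map_zero]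

/-- The Fock space matrices built from a MOPS. Division by `0` gives `0`. -/
def fockMatrices (hP : IsMOPS φ P) (hφ : IsState φ) : FockMatrices d :=
  let C : ∀ k : ℕ, (Fin (k + 1) → Fin d) → ℝ := fun k u =>
    (stateForm φ (P ⟨k + 1, u⟩) (P ⟨k + 1, u⟩)).re /
      (stateForm φ (P ⟨k, Matrix.vecTail u⟩) (P ⟨k, Matrix.vecTail u⟩)).re
  have hK : ∀ k u, kDiag C k u = (stateForm φ (P ⟨k, u⟩) (P ⟨k, u⟩)).re := by
    intro k
    induction k with
    | zero =>
      intro u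
      rw [kDiag, hP.isMonicSystem.apply_zero, stateForm_apply, mul_one,
        show adj (1 : NCPoly d) = 1 from adj_ncMonomial [], hφ.map_one, Complex.one_re]
    | succ k ih =>
      intro u
      rw [kDiag, ih]
      refine mul_div_cancel_of_imp' fun h => ?_
      rw [hP.stateForm_vecCons_eq_zero hφ u, Complex.zero_re]
      rw [← hφ.stateForm_self, h, Complex.ofReal_zero]
  { diagC := C
    T := fun i k => Matrix.of fun w u =>
      stateForm φ (P ⟨k, w⟩) (FreeAlgebra.ι ℂ i * P ⟨k, u⟩) / stateForm φ (P ⟨k, w⟩) (P ⟨k, w⟩)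
    diagC_nonneg := fun k u => div_nonneg (hφ.nonneg _) (hφ.nonneg _)
    -- Since `K_u = ‖P_u‖²`, the matrix `K T_i` has entries `⟨P_w, x_i P_u⟩`; it is Hermitian
    -- because `x_i` is symmetric for the form.
    comm := by
      intro i k
      have h : ∀ w u : Fin k → Fin d, stateForm φ (P ⟨k, w⟩) (P ⟨k, w⟩) *
          (stateForm φ (P ⟨k, w⟩) (FreeAlgebra.ι ℂ i * P ⟨k, u⟩) /
            stateForm φ (P ⟨k, w⟩) (P ⟨k, w⟩)) =
          stateForm φ (P ⟨k, w⟩) (FreeAlgebra.ι ℂ i * P ⟨k, u⟩) := fun w u =>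
        mul_div_cancel_of_imp' fun h => hφ.stateForm_eq_zero h _
      ext u w
      simp only [kMatrix, hK, hφ.stateForm_self, Matrix.mul_diagonal, Matrix.diagonal_mul,
        Matrix.conjTranspose_apply, Matrix.of_apply]
      rw [h]
      calc _ = conj (stateForm φ (P ⟨k, w⟩) (P ⟨k, w⟩) *
            (stateForm φ (P ⟨k, w⟩) (FreeAlgebra.ι ℂ i * P ⟨k, u⟩) /
              stateForm φ (P ⟨k, w⟩) (P ⟨k, w⟩))) := by
            rw [map_mul (starRingEnd ℂ), hφ.stateForm_conj, mul_comm]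
            rfl
        _ = _ := by rw [h, hφ.stateForm_conj, stateForm_ι_mul] }

theorem stateForm_mul_fockMatrices_T (hP : IsMOPS φ P) (hφ : IsState φ) (i : Fin d) {k : ℕ}
    (w u : Fin k → Fin d) :
    (hP.fockMatrices hφ).T i k w u * stateForm φ (P ⟨k, w⟩) (P ⟨k, w⟩) =
      stateForm φ (P ⟨k, w⟩) (FreeAlgebra.ι ℂ i * P ⟨k, u⟩) :=
  div_mul_cancel_of_imp fun h => hφ.stateForm_eq_zero h _

theorem stateForm_mul_fockMatrices_diagC (hP : IsMOPS φ P) (hφ : IsState φ) {k : ℕ}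
    (u : Fin (k + 1) → Fin d) :
    ((hP.fockMatrices hφ).diagC k u : ℂ) *
        stateForm φ (P ⟨k, Matrix.vecTail u⟩) (P ⟨k, Matrix.vecTail u⟩) =
      stateForm φ (P ⟨k + 1, u⟩) (P ⟨k + 1, u⟩) := by
  change (((_ / _ : ℝ) : ℝ) : ℂ) * _ = _
  rw [Complex.ofReal_div, hφ.stateForm_self, hφ.stateForm_self]
  exact div_mul_cancel_of_imp fun h => hP.stateForm_vecCons_eq_zero hφ u h

end IsMOPS

/-! ### Polynomials defined by a recursion, and the Fock space representation -/

namespace FockMatrices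

variable {d : ℕ} (F : FockMatrices d)

/-- The last term `δ_{i,u(1)} C_u Q_{(u(2),…,u(k))}` of the recursion. -/
def recursionTail (i : Fin d) (Q : MultiIndex d → NCPoly d) : MultiIndex d → NCPoly d
  | ⟨0, _⟩ => 0
  | ⟨k + 1, u⟩ =>
    if i = Matrix.vecHead u then (F.diagC k u : ℂ) • Q ⟨k, Matrix.vecTail u⟩ else 0

/-- `x_i Q_u - ∑ B_{i,w,u} Q_w - δ_{i,u(1)} C_u Q_{(u(2),…,u(k))}`. -/
def recursionStep (i : Fin d) (Q : MultiIndex d → NCPoly d) (k : ℕ) (u : Fin k → Fin d) :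
    NCPoly d :=
  FreeAlgebra.ι ℂ i * Q ⟨k, u⟩ - ∑ w : Fin k → Fin d, F.T i k w u • Q ⟨k, w⟩ -
    F.recursionTail i Q ⟨k, u⟩

/-- The polynomials defined by the recursion with coefficients `F`. -/
def polyAux : ∀ k : ℕ, (Fin k → Fin d) → NCPoly d
  | 0, _ => 1
  -- The trailing `- 0` is the value of `recursionTail` at the empty word, so that `poly_succ` has
  -- one form for all `k`.
  | 1, u => FreeAlgebra.ι ℂ (Matrix.vecHead u) * polyAux 0 (Matrix.vecTail u) -
      ∑ w, F.T (Matrix.vecHead u) 0 w (Matrix.vecTail u) • polyAux 0 w - 0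
  | k + 2, u => FreeAlgebra.ι ℂ (Matrix.vecHead u) * polyAux (k + 1) (Matrix.vecTail u) -
      ∑ w, F.T (Matrix.vecHead u) (k + 1) w (Matrix.vecTail u) • polyAux (k + 1) w -
      if Matrix.vecHead u = Matrix.vecHead (Matrix.vecTail u) then
        (F.diagC k (Matrix.vecTail u) : ℂ) • polyAux k (Matrix.vecTail (Matrix.vecTail u)) else 0

/-- The polynomials defined by the recursion with coefficients `F`, as one family. -/
def poly (u : MultiIndex d) : NCPoly d := F.polyAux u.1 u.2

theorem poly_succ {k : ℕ} (u : Fin (k + 1) → Fin d) :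
    F.poly ⟨k + 1, u⟩ = F.recursionStep (Matrix.vecHead u) F.poly k (Matrix.vecTail u) := by
  cases k <;> simp only [poly, polyAux, recursionStep, recursionTail]

theorem isRecursionOf_poly : F.IsRecursionOf F.poly where
  zero i u := by
    rw [poly_succ, recursionStep, recursionTail]
    simp
  succ i k u := by
    rw [F.poly_succ (Matrix.vecCons i u), recursionStep, Matrix.head_cons, Matrix.tail_cons]
    simp only [recursionTail]
    abel

/-- Serves both for `S` a step of the degree filtration and for `S` the space of null vectors. -/
theorem recursionTail_mem (Q : MultiIndex d → NCPoly d) (i : Fin d) (S : Submodule ℂ (NCPoly d))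
    (k : ℕ) (u : Fin k → Fin d) (h : ∀ m < k, ∀ v : Fin m → Fin d, Q ⟨m, v⟩ ∈ S) :
    F.recursionTail i Q ⟨k, u⟩ ∈ S := by
  cases k with
  | zero => exact S.zero_mem
  | succ k =>
    rw [recursionTail]
    split_ifs
    · exact S.smul_mem _ (h k (Nat.lt_succ_self k) _)
    · exact S.zero_mem

theorem recursionTail_sub (Q Q' : MultiIndex d → NCPoly d) (i : Fin d) (u : MultiIndex d) :
    F.recursionTail i (Q - Q') u = F.recursionTail i Q u - F.recursionTail i Q' u := by
  obtain ⟨k, u⟩ := u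
  cases k with
  | zero => simp [recursionTail]
  | succ k =>
    simp only [recursionTail]
    split_ifs <;> simp [smul_sub]

theorem recursionStep_sub (Q Q' : MultiIndex d → NCPoly d) (i : Fin d) (k : ℕ) (u : Fin k → Fin d) :
    F.recursionStep i (Q - Q') k u = F.recursionStep i Q k u - F.recursionStep i Q' k u := by
  simp only [recursionStep, recursionTail_sub, Pi.sub_apply, mul_sub, smul_sub,
    Finset.sum_sub_distrib]
  abel

theorem isMonicSystem_poly : IsMonicSystem F.poly := by
  rintro ⟨k, u⟩
  induction k using Nat.strong_induction_on with
  | _ k ih =>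
    have hm : ∀ m < k, ∀ v : Fin m → Fin d, F.poly ⟨m, v⟩ ∈ degreeLT d k := by
      intro m hm v
      have := add_mem (degreeLT_mono hm.le (ih m hm v))
        (ncMonomial_mem_degreeLT (w := List.ofFn v) (by simpa using hm))
      simpa using this
    cases k with
    | zero => simp [poly, polyAux, ncMonomial]
    | succ k =>
      have h1 := ι_mul_mem_degreeLT (Matrix.vecHead u) (ih k (Nat.lt_succ_self k) (Matrix.vecTail u))
      have h2 : ∑ w, F.T (Matrix.vecHead u) k w (Matrix.vecTail u) • F.poly ⟨k, w⟩ ∈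
          degreeLT d (k + 1) :=
        sum_mem fun w _ => Submodule.smul_mem _ _ (hm k (Nat.lt_succ_self k) w)
      have h3 := F.recursionTail_mem F.poly (Matrix.vecHead u) (degreeLT d (k + 1)) k
        (Matrix.vecTail u) fun m hm' v => hm m (by omega) v
      have h4 := sub_mem (sub_mem h1 h2) h3
      rw [poly_succ, recursionStep]
      convert h4 using 1
      simp only [ncMonomial_ofFn_succ, mul_sub]
      abel

/-- The linear map with `e_u ↦ P_u` intertwines `X_i` with the multiplication by `x_i`. -/
theorem IsRecursionOf.linearCombination_opX {F : FockMatrices d} {P : MultiIndex d → NCPoly d}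
    (h : F.IsRecursionOf P) (i : Fin d) (ξ : FockSpace d) :
    Finsupp.linearCombination ℂ P (F.opX i ξ) =
      FreeAlgebra.ι ℂ i * Finsupp.linearCombination ℂ P ξ := by
  classical
  have key : Finsupp.linearCombination ℂ P ∘ₗ F.opX i =
      LinearMap.mulLeft ℂ (FreeAlgebra.ι ℂ i) ∘ₗ Finsupp.linearCombination ℂ P := by
    refine Finsupp.lhom_ext' fun ⟨k, u⟩ => LinearMap.ext_ring ?_
    cases k with
    | zero =>
      simp [opX, creation, opT, annihilation, opC, fockOp, fockBasis, h.zero]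
    | succ k =>
      simp only [opX, creation, opT, annihilation, opC, fockOp, fockBasis, C, LinearMap.comp_apply,
        LinearMap.add_apply, Module.End.mul_apply, Finsupp.lsingle_apply,
        Finsupp.linearCombination_single, one_smul, map_add, map_sum, map_smul,
        Matrix.diagonal_apply, ite_smul, zero_smul, Finset.sum_ite_eq', Finset.mem_univ, if_true,
        LinearMap.mulLeft_apply, h.succ]
      split_ifs <;> simp
  exact LinearMap.congr_fun key ξ

/-- Transport along `e_u ↦ P_u`: the vacuum goes to `1`, `p(X)` becomes multiplication by `p`, and
`φ` pulls back to the vacuum coordinate because `P_u` is orthogonal to `P_∅ = 1` for `u ≠ ∅`. -/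
theorem IsRecursionOf.represents {F : FockMatrices d} {φ : NCPoly d →ₗ[ℂ] ℂ}
    {P : MultiIndex d → NCPoly d} (h : F.IsRecursionOf P) (hP : IsMOPS φ P) (hφ : IsState φ) :
    F.Represents φ := by
  have h1 : ∀ (p : NCPoly d) (ξ : FockSpace d),
      Finsupp.linearCombination ℂ P (FreeAlgebra.lift ℂ F.opX p ξ) =
        p * Finsupp.linearCombination ℂ P ξ := by
    intro p
    induction p using FreeAlgebra.induction with
    | grade0 r => intro ξ; simp [Algebra.algebraMap_eq_smul_one]
    | grade1 i => intro ξ; simpa using h.linearCombination_opX i ξ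
    | mul p q hp hq => intro ξ; simp [hp, hq, mul_assoc]
    | add p q hp hq => intro ξ; simp [hp, hq, add_mul]
  have hone : ∀ u : Fin 0 → Fin d, P ⟨0, u⟩ = 1 := hP.isMonicSystem.apply_zero
  have h2 : ∀ ξ : FockSpace d, φ (Finsupp.linearCombination ℂ P ξ) = ξ ⟨0, Matrix.vecEmpty⟩ := by
    intro ξ
    have key : φ ∘ₗ Finsupp.linearCombination ℂ P =
        Finsupp.lapply (⟨0, Matrix.vecEmpty⟩ : MultiIndex d) := by
      refine Finsupp.lhom_ext' fun u => LinearMap.ext_ring ?_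
      simp only [LinearMap.comp_apply, Finsupp.lsingle_apply, Finsupp.linearCombination_single,
        one_smul, Finsupp.lapply_apply]
      by_cases hu : u = ⟨0, Matrix.vecEmpty⟩
      · subst hu
        rw [hone, hφ.map_one, Finsupp.single_eq_same]
      · rw [Finsupp.single_eq_of_ne (Ne.symm hu)]
        have := hP.orthogonal ⟨0, Matrix.vecEmpty⟩ u (Ne.symm hu)
        rwa [hone, show adj (1 : NCPoly d) = 1 from adj_ncMonomial [], one_mul] at this
    exact LinearMap.congr_fun key ξ
  intro p
  have h3 : Finsupp.linearCombination ℂ P (vacuum d) = 1 := by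
    simp [vacuum, fockBasis, hone]
  have h4 := h2 (FreeAlgebra.lift ℂ F.opX p (vacuum d))
  rw [h1, h3, mul_one] at h4
  rw [h4]
  simp [inner, vacuum, fockBasis, kDiag]

end FockMatrices

/-! ### Correcting a MOPS by null vectors -/

namespace IsMOPS

variable {d : ℕ} {φ : NCPoly d →ₗ[ℂ] ℂ} {P : MultiIndex d → NCPoly d}

/-- Up to null vectors, a MOPS satisfies the recursion. -/
theorem stateForm_recursionStep (hP : IsMOPS φ P) (hφ : IsState φ) {k m : ℕ}
    (w : Fin m → Fin d) (u : Fin (k + 1) → Fin d) :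
    stateForm φ (P ⟨m, w⟩)
        ((hP.fockMatrices hφ).recursionStep (Matrix.vecHead u) P k (Matrix.vecTail u)) =
      stateForm φ (P ⟨m, w⟩) (P ⟨k + 1, u⟩) := by
  classical
  set F := hP.fockMatrices hφ with hF
  have orth : ∀ u v : MultiIndex d, u ≠ v → stateForm φ (P u) (P v) = 0 := hP.orthogonal
  have hne : ∀ {a b : ℕ} (v : Fin a → Fin d) (v' : Fin b → Fin d), a ≠ b →
      stateForm φ (P ⟨a, v⟩) (P ⟨b, v'⟩) = 0 := fun v v' h =>
    orth _ _ fun e => h (congrArg Sigma.fst e)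
  have hne' : ∀ {a : ℕ} (v v' : Fin a → Fin d), v ≠ v' →
      stateForm φ (P ⟨a, v⟩) (P ⟨a, v'⟩) = 0 := fun v v' h =>
    orth _ _ fun e => h (by simpa using e)
  have hsum : ∀ hm : m ≠ k, ∑ v : Fin k → Fin d, F.T (Matrix.vecHead u) k v (Matrix.vecTail u) *
      stateForm φ (P ⟨m, w⟩) (P ⟨k, v⟩) = 0 := fun hm =>
    Finset.sum_eq_zero fun v _ => by rw [hne _ _ hm, mul_zero]
  have htail : ∀ hm : k ≠ m + 1, stateForm φ (P ⟨m, w⟩)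
      (F.recursionTail (Matrix.vecHead u) P ⟨k, Matrix.vecTail u⟩) = 0 := by
    intro hm
    refine LinearMap.mem_ker.mp ?_
    cases k with
    | zero => exact Submodule.zero_mem _
    | succ k =>
      rw [FockMatrices.recursionTail]
      split_ifs
      · exact Submodule.smul_mem _ _ (hne _ _ (by omega))
      · exact Submodule.zero_mem _
  rw [FockMatrices.recursionStep, map_sub, map_sub, map_sum]
  simp only [map_smul, smul_eq_mul]
  -- For `m < k` only the `C` term can contribute, with `m + 1 = k`; for `m = k` the `T` term
  -- cancels `⟨P_w, x_i P_u⟩`; for `m > k` only the leading term survives.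
  rcases lt_trichotomy m k with hm | hm | hm
  · rw [hsum hm.ne, hP.stateForm_ι_mul_of_gt hφ _ _ _ hm, hne w u (by omega), sub_zero]
    by_cases hk : k = m + 1
    · subst hk
      rw [FockMatrices.recursionTail]
      split_ifs with hi
      · rw [map_smul, smul_eq_mul, hi]
        by_cases hw : w = Matrix.vecTail (Matrix.vecTail u)
        · subst hw
          rw [hF, hP.stateForm_mul_fockMatrices_diagC hφ]
          simp
        · rw [hne' _ _ hw, mul_zero, sub_zero]
          refine hne' _ _ fun e => hw ?_
          rw [← e]
          simp
      · rw [map_zero, sub_zero]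
        refine hne' _ _ fun e => hi ?_
        rw [← e]
        simp
    · rw [htail hk, sub_zero]
      exact hne _ _ (by omega)
  · subst hm
    rw [htail (by omega), sub_zero, hne w u (by omega), Finset.sum_eq_single w,
      hF, hP.stateForm_mul_fockMatrices_T hφ, sub_self]
    · intro v _ hv
      rw [hne' _ _ (Ne.symm hv), mul_zero]
    · simp
  · rw [hsum hm.ne', htail (by omega), sub_zero, sub_zero, hP.stateForm_ι_mul_of_lt w u hm]

/-- The polynomials given by the recursion differ from the MOPS by null vectors. -/
theorem stateForm_poly_sub (hP : IsMOPS φ P) (hφ : IsState φ) (k : ℕ) (u : Fin k → Fin d)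
    (q : NCPoly d) : stateForm φ q ((hP.fockMatrices hφ).poly ⟨k, u⟩ - P ⟨k, u⟩) = 0 := by
  -- `N` is the radical of the form. The recursion is linear in the family, so the differences
  -- satisfy it up to an error in `N`.
  let N : Submodule ℂ (NCPoly d) := ⨅ q, LinearMap.ker (stateForm φ q)
  have hN : ∀ p, p ∈ N ↔ ∀ q, stateForm φ q p = 0 := fun p => by simp [N, Submodule.mem_iInf]
  suffices h : ∀ u : Fin k → Fin d, ((hP.fockMatrices hφ).poly - P) ⟨k, u⟩ ∈ N from
    (hN _).mp (h u) q
  clear u q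
  induction k using Nat.strong_induction_on with
  | _ k ih =>
    intro u
    cases k with
    | zero =>
      rw [Pi.sub_apply, hP.isMonicSystem.apply_zero, FockMatrices.isMonicSystem_poly _ |>.apply_zero,
        sub_self]
      exact N.zero_mem
    | succ k =>
      have h1 : (hP.fockMatrices hφ).recursionStep (Matrix.vecHead u)
          ((hP.fockMatrices hφ).poly - P) k (Matrix.vecTail u) ∈ N := by
        refine sub_mem (sub_mem ?_ (sum_mem fun w _ =>
          N.smul_mem _ (ih k (Nat.lt_succ_self k) w)))
          (FockMatrices.recursionTail_mem _ _ _ _ _ _ fun m hm v => ih m (by omega) v)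
        -- The radical is stable under left multiplication by `x_i`, as `x_i` is symmetric.
        rw [hN]
        intro q
        rw [stateForm_ι_mul]
        exact (hN _).mp (ih k (Nat.lt_succ_self k) _) _
      have h2 : (hP.fockMatrices hφ).recursionStep (Matrix.vecHead u) P k (Matrix.vecTail u) -
          P ⟨k + 1, u⟩ ∈ N := by
        rw [hN]
        intro q
        -- This puts `q` in the linear slot, so that it suffices to test on the spanning family `P`.
        rw [← hφ.stateForm_conj, map_eq_zero]
        refine LinearMap.mem_ker.mp ?_
        have : Submodule.span ℂ (Set.range P) ≤ LinearMap.ker (stateForm φ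
            ((hP.fockMatrices hφ).recursionStep (Matrix.vecHead u) P k (Matrix.vecTail u) -
              P ⟨k + 1, u⟩)) := by
          refine Submodule.span_le.mpr ?_
          rintro _ ⟨⟨m, w⟩, rfl⟩
          change stateForm φ _ _ = 0
          rw [← hφ.stateForm_conj, map_sub, hP.stateForm_recursionStep, sub_self, map_zero]
        exact this (by rw [hP.isMonicSystem.span_eq_top]; trivial)
      have h3 := add_mem h1 h2
      rw [FockMatrices.recursionStep_sub, ← FockMatrices.poly_succ] at h3
      simpa using h3

/-- Null vectors do not change the form, so orthogonality is inherited from `P`; monicity comes from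
the recursion itself. -/
theorem poly (hP : IsMOPS φ P) (hφ : IsState φ) : IsMOPS φ (hP.fockMatrices hφ).poly where
  monic := (hP.fockMatrices hφ).isMonicSystem_poly
  orthogonal u v huv := by
    have h1 := hP.stateForm_poly_sub hφ v.1 v.2 ((hP.fockMatrices hφ).poly u)
    have h2 := hP.stateForm_poly_sub hφ u.1 u.2 (P v)
    rw [map_sub, sub_eq_zero] at h1 h2
    rw [← stateForm_apply]
    refine h1.trans ?_
    rw [← hφ.stateForm_conj]
    refine (congrArg _ (h2.trans (hP.orthogonal v u huv.symm))).trans (map_zero _)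

end IsMOPS

/-! ### Coefficients and order of non-commutative series -/

namespace NCSeries

variable {d : ℕ} {R : Type*} [Ring R]

theorem coeff_z_mul_nil (i : Fin d) (f : NCSeries d R) : (z i * f).coeff [] = 0 := by
  rw [coeff_nil_mul, coeff_nil_z, zero_mul]

theorem coeff_z_mul_cons (i j : Fin d) (f : NCSeries d R) (w : List (Fin d)) :
    (z i * f).coeff (j :: w) = if j = i then f.coeff w else 0 := by
  rw [coeff_cons_mul, coeff_nil_z, zero_mul, zero_add]
  by_cases h : j = i
  · have : tail j (z i : NCSeries d R) = 1 := by
      ext v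
      simp [tail, z, coeff_one, h]
    rw [this, one_mul, if_pos h]
  · have : tail j (z i : NCSeries d R) = 0 := by
      ext v
      simp [tail, z, coeff_zero, h]
    rw [this, zero_mul_aux, if_neg h, coeff_zero]

theorem coeff_const_mul (a : R) (f : NCSeries d R) (w : List (Fin d)) :
    (const a * f).coeff w = a * f.coeff w := by
  cases w with
  | nil => rw [coeff_nil_mul]; rfl
  | cons j w =>
    have : tail j (const a : NCSeries d R) = 0 := by
      ext v
      simp [tail, const, coeff_zero]
    rw [coeff_cons_mul, this, zero_mul_aux, coeff_zero, add_zero]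
    rfl

theorem coeff_sum {ι : Type*} (s : Finset ι) (f : ι → NCSeries d R) (w : List (Fin d)) :
    (∑ i ∈ s, f i).coeff w = ∑ i ∈ s, (f i).coeff w := by
  classical
  induction s using Finset.induction_on with
  | empty => rfl
  | insert a s ha ih => rw [Finset.sum_insert ha, Finset.sum_insert ha, coeff_add, ih]

/-- The coefficients of all words of length less than `m` vanish. -/
def OrderGE (m : ℕ) (f : NCSeries d R) : Prop := ∀ w : List (Fin d), w.length < m → f.coeff w = 0

theorem OrderGE.mul_left {m : ℕ} {f : NCSeries d R} (hf : OrderGE m f) (g : NCSeries d R) :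
    OrderGE m (g * f) := fun w hw => by
  rw [coeff_mul]
  exact Finset.sum_eq_zero fun n _ => by
    rw [hf _ (lt_of_le_of_lt (by simp) hw), mul_zero]

theorem OrderGE.z_mul {m : ℕ} {f : NCSeries d R} (hf : OrderGE m f) (i : Fin d) :
    OrderGE (m + 1) (z i * f) := fun w hw => by
  cases w with
  | nil => exact coeff_z_mul_nil i f
  | cons j w =>
    rw [coeff_z_mul_cons, hf w (by simpa using hw), ite_self]

theorem OrderGE.sum {ι : Type*} {m : ℕ} {s : Finset ι} {f : ι → NCSeries d R}
    (hf : ∀ i ∈ s, OrderGE m (f i)) : OrderGE m (∑ i ∈ s, f i) := fun w hw => by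
  rw [coeff_sum]
  exact Finset.sum_eq_zero fun i hi => hf i hi w hw

theorem OrderGE.map {S : Type*} [Ring S] {m : ℕ} {f : NCSeries d R} (hf : OrderGE m f) {h : R → S}
    (h0 : h 0 = 0) : OrderGE m (f.map h) := fun w hw => by
  change h (f.coeff w) = 0
  rw [hf w hw, h0]

theorem orderGE_zero (f : NCSeries d R) : OrderGE 0 f := fun _ hw => absurd hw (Nat.not_lt_zero _)

end NCSeries

/-! ### Blocks of matrix series -/

open NCSeries

theorem map_block_sub {d k : ℕ} (i j : Fin d) (A B : MatrixSeries d (k + 1)) :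
    (A - B).map (block i j) = A.map (block i j) - B.map (block i j) := by
  ext w
  rw [coeff_sub]
  simp only [NCSeries.map, coeff_sub]
  rfl

/-- The series `(∑ E_k z_k) H`. -/
def raise {d s : ℕ} (H : MatrixSeries d s) : MatrixSeries d (s + 1) :=
  ⟨fun w => match w with
    | [] => 0
    | k :: w => Matrix.of fun u v =>
        if Matrix.vecHead u = k then H.coeff w (Matrix.vecTail u) (Matrix.vecTail v) else 0⟩

/-- Block multiplication: the `k`-th block row of `raise H` is `z_k H`. The entries of `raise H` do
not depend on the head of the column index, so the second `j` on the left is an arbitrary choice. -/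
theorem block_mul_raise {d s : ℕ} (j : Fin d)
    (A : Matrix (Fin (s + 1) → Fin d) (Fin (s + 1) → Fin d) ℂ) (H : MatrixSeries d s)
    (w : List (Fin d)) :
    block j j (A * (raise H).coeff w) = ∑ k, block j k A * (z k * H).coeff w := by
  cases w with
  | nil =>
    simp only [coeff_z_mul_nil, mul_zero, Finset.sum_const_zero]
    change block j j (A * 0) = 0
    rw [mul_zero]
    rfl
  | cons k w =>
    simp only [coeff_z_mul_cons, mul_ite, mul_zero, Finset.sum_ite_eq, Finset.mem_univ, if_true]
    ext u v
    simp only [block, Matrix.of_apply, Matrix.mul_apply, raise]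
    rw [← (Fin.consEquiv fun _ : Fin (s + 1) => Fin d).sum_comp, Fintype.sum_prod_type,
      Finset.sum_eq_single k]
    · refine Finset.sum_congr rfl fun y _ => ?_
      rw [if_pos (by simp [Fin.consEquiv, Matrix.vecHead])]
      rfl
    · intro b _ hb
      refine Finset.sum_eq_zero fun y _ => ?_
      rw [if_neg (by simpa [Fin.consEquiv, Matrix.vecHead] using hb), mul_zero]
    · simp

theorem map_block_mul_raise {d s : ℕ} (j : Fin d) (A : MatrixSeries d (s + 1))
    (H : MatrixSeries d s) :
    (A * raise H).map (block j j) = ∑ k, A.map (block j k) * (z k * H) := by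
  ext1
  funext w
  rw [coeff_sum]
  simp only [NCSeries.map, coeff_mul _ (z _ * H)]
  rw [Finset.sum_comm, coeff_mul]
  ext u v
  simp only [block, Matrix.of_apply, Matrix.sum_apply]
  refine Finset.sum_congr rfl fun n _ => ?_
  have := congrFun (congrFun (block_mul_raise j (A.coeff (w.take n)) H (w.drop n)) u) v
  simpa only [block, Matrix.of_apply, Matrix.sum_apply] using this

/-! ### Approximation by the finite continued fractions -/

namespace FockMatrices

variable {d : ℕ} (F : FockMatrices d)

/-- If `H` solves the three-term recursion with inhomogeneity `R`, then `denominator n s * H s`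
agrees with `R s` up to order `n`. -/
theorem orderGE_denominator_mul_sub (H R : ∀ s, MatrixSeries d s)
    (hR : ∀ s, R (s + 1) = raise (H s))
    (hH : ∀ s, H s = R s + ∑ i, z i * (const (F.T i s) * H s) +
      ∑ j, z j * (const (F.C s) * H (s + 1)).map (block j j)) (n s : ℕ) :
    OrderGE (n + 1) (F.denominator n s * H s - R s) := by
  induction n generalizing s with
  | zero =>
    have : F.denominator 0 s * H s - R s =
        ∑ j, z j * (const (F.C s) * H (s + 1)).map (block j j) := by
      rw [denominator, sub_mul, one_mul, Finset.sum_mul]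
      nth_rw 1 [hH s]
      simp only [mul_assoc]
      abel
    rw [this]
    exact OrderGE.sum fun j _ => (orderGE_zero _).z_mul j
  | succ n ih =>
    have : F.denominator (n + 1) s * H s - R s =
        ∑ j, z j * (const (F.C s) * (Ring.inverse (F.denominator n (s + 1)) *
          (F.denominator n (s + 1) * H (s + 1) - R (s + 1)))).map (block j j) := by
      -- As `R (s + 1) = (∑ E_k z_k) H s`, the part of the error coming from `R (s + 1)` is exactly
      -- the fraction in `denominator (n + 1) s`, applied to `H s`.
      have h1 : ∀ j : Fin d, (const (F.C s) * (Ring.inverse (F.denominator n (s + 1)) *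
          (F.denominator n (s + 1) * H (s + 1) - R (s + 1)))).map (block j j) =
          (const (F.C s) * H (s + 1)).map (block j j) -
            ∑ k, barFraction j k (const (F.C s)) (F.denominator n (s + 1)) * (z k * H s) := by
        intro j
        rw [mul_sub, ← mul_assoc, Ring.inverse_mul_cancel _ (F.isUnit_denominator n (s + 1)),
          one_mul, mul_sub, map_block_sub, hR, ← mul_assoc, map_block_mul_raise]
        rfl
      simp only [h1]
      simp only [mul_sub, Finset.sum_sub_distrib, Finset.mul_sum]
      rw [denominator, sub_mul, sub_mul, one_mul, Finset.sum_mul, Finset.sum_mul]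
      -- Only the `H s` coming from the leading `1` is expanded; the remaining occurrences cancel
      -- against it.
      nth_rw 1 [hH s]
      simp only [mul_assoc, Finset.sum_mul]
      abel
    rw [this]
    -- The left factor `z_j` raises the order by one; the other operations preserve it.
    exact OrderGE.sum fun j _ =>
      ((((ih (s + 1)).mul_left _).mul_left _).map rfl).z_mul j

/-! ### Coordinates of the vectors `X_w Ω` and their generating series -/

/-- The vector `X_w Ω`. -/
def wordVector (w : List (Fin d)) : FockSpace d :=
  FreeAlgebra.lift ℂ F.opX (ncMonomial w) (vacuum d)

theorem wordVector_nil : F.wordVector [] = vacuum d := by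
  simp [wordVector, ncMonomial]

theorem wordVector_cons (i : Fin d) (w : List (Fin d)) :
    F.wordVector (i :: w) = F.opX i (F.wordVector w) := by
  simp [wordVector, ncMonomial]

theorem fockOp_single (f : MultiIndex d → FockSpace d) (u : MultiIndex d) (a : ℂ) :
    fockOp f (Finsupp.single u a) = a • f u := by
  simp [fockOp]

theorem fockBasis_apply_self {k : ℕ} (u v : Fin k → Fin d) :
    fockBasis u ⟨k, v⟩ = if u = v then 1 else 0 := by
  classical
  simp [fockBasis, Finsupp.single_apply]

theorem fockBasis_apply_of_ne {k m : ℕ} (h : k ≠ m) (u : Fin k → Fin d) (v : Fin m → Fin d) :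
    fockBasis u ⟨m, v⟩ = 0 := by
  classical
  rw [fockBasis, Finsupp.single_apply, if_neg]
  exact fun e => h (congrArg Sigma.fst e)

theorem apply_eq_of_fockBasis {L L' : FockSpace d →ₗ[ℂ] ℂ}
    (h : ∀ (k : ℕ) (u : Fin k → Fin d), L (fockBasis u) = L' (fockBasis u)) (ξ : FockSpace d) :
    L ξ = L' ξ := by
  have : L = L' := Finsupp.lhom_ext' fun ⟨k, u⟩ => LinearMap.ext_ring (h k u)
  rw [this]

/-- A coordinate as a linear functional. -/
abbrev coord {k : ℕ} (u : Fin k → Fin d) : FockSpace d →ₗ[ℂ] ℂ := Finsupp.lapply ⟨k, u⟩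

theorem fockOp_fockBasis (f : MultiIndex d → FockSpace d) {k : ℕ} (u : Fin k → Fin d) :
    fockOp f (fockBasis u) = f ⟨k, u⟩ := by
  rw [fockBasis, fockOp_single, one_smul]

theorem vecCons_eq_iff {k : ℕ} (i : Fin d) (v : Fin k → Fin d) (u : Fin (k + 1) → Fin d) :
    Matrix.vecCons i v = u ↔ Matrix.vecHead u = i ∧ v = Matrix.vecTail u := by
  constructor
  · rintro rfl
    simp
  · rintro ⟨rfl, rfl⟩
    simp

theorem creation_apply_zero (i : Fin d) (ξ : FockSpace d) (u : Fin 0 → Fin d) :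
    creation i ξ ⟨0, u⟩ = 0 := by
  refine apply_eq_of_fockBasis (L := coord u ∘ₗ creation i) (L' := 0) (fun k v => ?_) ξ
  simp only [LinearMap.comp_apply, creation, fockOp_fockBasis, Finsupp.lapply_apply,
    LinearMap.zero_apply]
  exact fockBasis_apply_of_ne (by simp) _ _

theorem creation_apply_succ (i : Fin d) (ξ : FockSpace d) {k : ℕ} (u : Fin (k + 1) → Fin d) :
    creation i ξ ⟨k + 1, u⟩ =
      if Matrix.vecHead u = i then ξ ⟨k, Matrix.vecTail u⟩ else 0 := by
  classical
  refine apply_eq_of_fockBasis (L := coord u ∘ₗ creation i)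
    (L' := if Matrix.vecHead u = i then coord (Matrix.vecTail u) else 0) (fun m v => ?_) ξ |>.trans
    (by split_ifs <;> rfl)
  have : ∀ η : FockSpace d, (if Matrix.vecHead u = i then coord (Matrix.vecTail u) else 0) η =
    if Matrix.vecHead u = i then η ⟨k, Matrix.vecTail u⟩ else 0 := by
    intro η; split_ifs <;> rfl
  rw [this]
  simp only [LinearMap.comp_apply, creation, fockOp_fockBasis, Finsupp.lapply_apply]
  by_cases hm : m = k
  · subst hm
    simp only [fockBasis_apply_self, vecCons_eq_iff, ite_and]
  · rw [fockBasis_apply_of_ne (by simpa using hm), fockBasis_apply_of_ne hm, ite_self]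

theorem opT_apply (i : Fin d) (ξ : FockSpace d) {k : ℕ} (u : Fin k → Fin d) :
    F.opT i ξ ⟨k, u⟩ = ∑ w : Fin k → Fin d, F.T i k u w * ξ ⟨k, w⟩ := by
  classical
  refine apply_eq_of_fockBasis (L := coord u ∘ₗ F.opT i)
    (L' := ∑ w : Fin k → Fin d, F.T i k u w • coord w) (fun m v => ?_) ξ |>.trans
    (by simp)
  simp only [LinearMap.comp_apply, opT, fockOp_fockBasis, Finsupp.lapply_apply, Finsupp.coe_finsetSum,
    Finset.sum_apply, LinearMap.sum_apply, LinearMap.smul_apply, Finsupp.smul_apply, smul_eq_mul]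
  by_cases hm : m = k
  · subst hm
    simp [fockBasis_apply_self]
  · simp [fockBasis_apply_of_ne hm]

theorem annihilation_opC_apply (i : Fin d) (ξ : FockSpace d) {k : ℕ} (u : Fin k → Fin d) :
    annihilation i (F.opC ξ) ⟨k, u⟩ =
      F.diagC k (Matrix.vecCons i u) * ξ ⟨k + 1, Matrix.vecCons i u⟩ := by
  classical
  refine apply_eq_of_fockBasis (L := coord u ∘ₗ annihilation i ∘ₗ F.opC)
    (L' := (F.diagC k (Matrix.vecCons i u) : ℂ) • coord (Matrix.vecCons i u)) (fun m v => ?_) ξ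
  simp only [LinearMap.comp_apply, opC, fockOp_fockBasis, Finsupp.lapply_apply,
    LinearMap.smul_apply, smul_eq_mul]
  match m, v with
  | 0, v => simp [fockBasis_apply_of_ne]
  | m + 1, v =>
    simp only [C, Matrix.diagonal_apply, ite_smul, zero_smul, Finset.sum_ite_eq', Finset.mem_univ,
      if_true, map_smul, annihilation, fockOp_fockBasis, Finsupp.smul_apply, smul_eq_mul]
    by_cases hm : m = k
    · subst hm
      simp only [fockBasis_apply_self, eq_comm (a := v), vecCons_eq_iff]
      by_cases h : i = Matrix.vecHead v <;> by_cases h' : u = Matrix.vecTail v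
      · simp [h, h', fockBasis_apply_self]
      · simp [h, h', fockBasis_apply_self, eq_comm (a := Matrix.vecTail v)]
      · simp [h, Ne.symm h]
      · simp [h, Ne.symm h]
    · rw [fockBasis_apply_of_ne (by simpa using hm)]
      split_ifs <;> simp [fockBasis_apply_of_ne hm]

theorem opX_apply (i : Fin d) (ξ : FockSpace d) {k : ℕ} (u : Fin k → Fin d) :
    F.opX i ξ ⟨k, u⟩ = creation i ξ ⟨k, u⟩ + ∑ w : Fin k → Fin d, F.T i k u w * ξ ⟨k, w⟩ +
      F.diagC k (Matrix.vecCons i u) * ξ ⟨k + 1, Matrix.vecCons i u⟩ := by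
  rw [opX, LinearMap.add_apply, LinearMap.add_apply, Finsupp.add_apply, Finsupp.add_apply,
    opT_apply, Module.End.mul_apply, annihilation_opC_apply]

/-- The generating series of the level `s` components of the vectors `X_w Ω`, as matrices with
equal columns. -/
def levelSeries (s : ℕ) : MatrixSeries d s :=
  ⟨fun w => Matrix.of fun u _ => F.wordVector w ⟨s, u⟩⟩

/-- The inhomogeneity in the recursion for `levelSeries`. -/
def levelSource : ∀ s : ℕ, MatrixSeries d s
  | 0 => 1
  | s + 1 => raise (F.levelSeries s)

/-- This is `X_{(i,w)} Ω = X_i X_w Ω` read off at level `s`: creation gives the source, `T_i` stays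
on the level, and `a_j^- C` comes down from level `s + 1`. The empty word contributes the constant
`1` at level `0`. -/
theorem levelSeries_eq (s : ℕ) : F.levelSeries s = F.levelSource s +
    ∑ i, z i * (const (F.T i s) * F.levelSeries s) +
      ∑ j, z j * (const (F.C s) * F.levelSeries (s + 1)).map (block j j) := by
  classical
  ext1
  funext w
  rw [coeff_add, coeff_add, coeff_sum, coeff_sum]
  cases w with
  | nil =>
    simp only [coeff_z_mul_nil, Finset.sum_const_zero, add_zero]
    ext u v
    simp only [levelSeries, wordVector_nil, vacuum, Matrix.of_apply]
    cases s with
    | zero =>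
      rw [fockBasis_apply_self, if_pos (Subsingleton.elim _ _), levelSource, coeff_one, if_pos rfl,
        Subsingleton.elim u v, Matrix.one_apply_eq]
    | succ s =>
      rw [fockBasis_apply_of_ne (by simp)]
      rfl
  | cons k w =>
    simp only [coeff_z_mul_cons, Finset.sum_ite_eq, Finset.mem_univ, if_true]
    ext u v
    simp only [Matrix.add_apply, levelSeries, NCSeries.map, block, coeff_const_mul, Matrix.of_apply,
      wordVector_cons, opX_apply, Matrix.mul_apply, C, Matrix.diagonal_apply, ite_mul, zero_mul,
      Finset.sum_ite_eq, Finset.mem_univ, if_true]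
    congr 2
    cases s with
    | zero =>
      rw [creation_apply_zero, levelSource, coeff_one, if_neg (List.cons_ne_nil _ _)]
      rfl
    | succ s =>
      rw [creation_apply_succ]
      rfl

theorem inner_vacuum (ξ : FockSpace d) : F.inner (vacuum d) ξ = ξ ⟨0, Matrix.vecEmpty⟩ := by
  simp [inner, vacuum, fockBasis, kDiag]

theorem continuedFractionEq_of_represents {φ : NCPoly d →ₗ[ℂ] ℂ} (h1 : φ 1 = 1)
    (h : F.Represents φ) : F.ContinuedFractionEq (1 + momentSeries φ) := by
  intro w
  -- The `n`-th convergent is exact on all words of length at most `n`.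
  filter_upwards [Filter.eventually_ge_atTop w.length] with n hn
  have h2 : OrderGE (n + 1) (F.levelSeries 0 - F.convergent n) := by
    have := (F.orderGE_denominator_mul_sub F.levelSeries F.levelSource (fun _ => rfl)
      F.levelSeries_eq n 0).mul_left (Ring.inverse (F.denominator n 0))
    rwa [mul_sub, ← mul_assoc, Ring.inverse_mul_cancel _ (F.isUnit_denominator n 0), one_mul,
      levelSource, mul_one] at this
  have h3 := h2 w (by omega)
  rw [coeff_sub, sub_eq_zero] at h3
  rw [← h3, coeff_add, coeff_one]
  have h4 : φ (ncMonomial w) = F.wordVector w ⟨0, Matrix.vecEmpty⟩ := by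
    rw [h, inner_vacuum, wordVector]
  change F.wordVector w ⟨0, Matrix.vecEmpty⟩ = _ + if w = [] then 0 else φ (ncMonomial w)
  rw [← h4]
  split_ifs with hw
  · simp [hw, ncMonomial, h1]
  · simp

end FockMatrices

end

theorem mainTheorem4 (d : ℕ) (φ : NCPoly d →ₗ[ℂ] ℂ) (hφ : IsState φ)
    (hMOPS : ∃ P : MultiIndex d → NCPoly d, IsMOPS φ P) :
    (∃ F : FockMatrices d, F.Represents φ ∧
      ∃ P : MultiIndex d → NCPoly d, IsMOPS φ P ∧ F.IsRecursionOf P) ∧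
    ∀ F : FockMatrices d,
      (F.Represents φ ∨ ∃ P : MultiIndex d → NCPoly d, IsMOPS φ P ∧ F.IsRecursionOf P) →
        F.ContinuedFractionEq (1 + momentSeries φ) := by
  obtain ⟨P, hP⟩ := hMOPS
  have hrec := (hP.fockMatrices hφ).isRecursionOf_poly
  refine ⟨⟨hP.fockMatrices hφ, hrec.represents (hP.poly hφ) hφ, _, hP.poly hφ, hrec⟩, ?_⟩
  rintro F (hF | ⟨Q, hQ, hFQ⟩)
  · exact F.continuedFractionEq_of_represents hφ.map_one hF
  · exact F.continuedFractionEq_of_represents hφ.map_one (hFQ.represents hQ hφ)
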